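/- Let $g:[-1,1]\setminus\{0\}\to[-1,1]$ be a Lorenz map: $g$ is $C^\infty$ on $[-1,1]\setminus\{0\}$, has distinct one-sided limits at $0$, satisfies $|g'(x)|\to\infty$ as $x\to0$, and there is $\theta>0$ with $|g'|\ge\theta^{-1}>\sqrt2$. Let $0<\delta<1$, $\hat I=(-\delta,\delta)$, and let $\hat g$ be a Markov return map of $g$ to $\hat I$. That is, there are pairwise disjoint nonempty open intervals $\hat I(l)\subset\hat I$, $l\in\mathbb N$, covering $\hat I$ up to a Lebesgue null set, and a Lebesgue integrable return time $\hat r$ which is constant and equal to a positive integer $r_l$ on each $\hat I(l)$, such that $\hat g=g^{r_l}$ is defined on $\hat I(l)$ and maps $\hat I(l)$ diffeomorphically onto $\hat I$. Moreover, there is $c\in(0,1)$ such that $$\log\frac{|\hat g'(x)|}{|\hat g'(y)|}\le c^{\,n(x,y)}$$ for any two distinct points $x,y$ of a common $\hat I(l)$ all of whose $\hat g$-iterates are defined, where $n(x,y)$ is the least $n$ for which $\hat g^n(x)$ and $\hat g^n(y)$ lie in different intervals of the partition. Let $\hat\mu$ be an absolutely continuous ergodic $\hat g$-invariant probability measure on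 $\hat I$. For Lebesgue almost every $x\in\hat I$ all iterates $\hat g^n(x)$ are defined, and the itinerary $(l_n)_{n\ge0}$ of $x$, given by $\hat g^n(x)\in\hat I(l_n)$, identifies $\hat\mu$ with a probability measure on $\mathbb N^{\{n\ge0\}}$, again denoted by $\hat\mu$. Let $N=\mathbb N^{\mathbb Z}$, with the topology generated by cylinders, let $f:N\to N$, $f((x_n)_n)=(x_{n+1})_n$, be the shift, and let $\pi_s:N\to\mathbb N^{\{n<0\}}$ and $\pi_u:N\to\mathbb N^{\{n\ge0\}}$ be the natural projections. Let $\mu$ be the lift of $\hat\mu$, i.e. the $f$-invariant ergodic probability measure on $N$ with $(\pi_u)_*\mu=\hat\mu$, and put $\mu_s=(\pi_s)_*\mu$, $\mu_u=(\pi_u)_*\mu$. Then $\mu$ has product structure with a continuous density bounded away from zero and infinity: there are a continuous function $\omega:N\to(0,+\infty)$ and constants $0<a\le b<\infty$ with $a\le\omega(x)\le b$ for all $x\in N$ such that, identifying $N$ with $\mathbb N^{\{n<0\}}\times\mathbb N^{\{n\ge0\}}$ through $x\mapsto(\pi_s(x),\pi_u(x))$, $$\mu=\omega\,(\mu_s\times\mu_u).$$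 -/

import Mathlib

namespace LorenzShift

noncomputable section

open Set Filter Topology MeasureTheory

/-! ### The one-dimensional Lorenz map and its Markov return map -/

/-- The punctured interval `[-1,1] \ {0}`, the domain of a Lorenz map. -/
def lorenzDomain : Set ℝ := Icc (-1) 1 \ {0}

open scoped ContDiff in
/-- `g` is a one-dimensional Lorenz map `[-1,1] \ {0} → [-1,1]`; its values elsewhere are
irrelevant. -/
structure IsLorenzMap (g : ℝ → ℝ) : Prop where
  mapsTo : MapsTo g lorenzDomain (Icc (-1) 1)
  smooth : ContDiffOn ℝ ∞ g lorenzDomain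
  /-- one-sided limits exist at the singular point, and they differ -/
  discontinuity : ∃ L R : ℝ, Tendsto g (𝓝[<] 0) (𝓝 L) ∧ Tendsto g (𝓝[>] 0) (𝓝 R) ∧ L ≠ R
  /-- the left and right derivatives at the singular point are infinite -/
  deriv_infinite : Tendsto (fun x => |deriv g x|) (𝓝[≠] 0) atTop
  /-- uniform expansion, with a rate larger than `√2` -/
  expanding : ∃ θ : ℝ, 0 < θ ∧ √2 < θ⁻¹ ∧
    ∀ x ∈ lorenzDomain, θ⁻¹ ≤ |derivWithin g lorenzDomain x|

/-- The combinatorial data of a return map: the branch domain number `l` is the open interval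
`(left l, right l)`, and the return time there is `time l`. -/
structure ReturnData where
  left : ℕ → ℝ
  right : ℕ → ℝ
  time : ℕ → ℕ

namespace ReturnData

variable (D : ReturnData) (g : ℝ → ℝ)

/-- The `l`-th element of the partition. -/
def piece (l : ℕ) : Set ℝ := Ioo (D.left l) (D.right l)

/-- The union of the partition elements: the domain of the return map. -/
def domain : Set ℝ := ⋃ l, D.piece l

open Classical in
/-- The label of the partition element containing `x` (and `0` if there is none). -/
def label (x : ℝ) : ℕ := if h : ∃ l, x ∈ D.piece l then h.choose else 0

/-- The return time, as a function of the point. -/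
def returnTime (x : ℝ) : ℕ := D.time (D.label x)

open Classical in
/-- The return map `x ↦ g^{r(x)}(x)`. Off its domain it is extended by the identity, so that a
point which leaves the domain never comes back to it. -/
def returnMap (x : ℝ) : ℝ := if x ∈ D.domain then g^[D.returnTime x] x else x

/-- The points all of whose iterates under the return map are defined. -/
def core : Set ℝ := {x | ∀ n : ℕ, (D.returnMap g)^[n] x ∈ D.domain}

/-- The itinerary `(l_n)_{n ≥ 0}` of a point: its `n`-th iterate lies in the `l_n`-th partition
element. On `core` this is the inverse of the coding `(l_n) ↦ ⋂ ĝ^{-n}(Î(l_n))`. -/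
def itinerary (x : ℝ) : ℕ → ℕ := fun n => D.label ((D.returnMap g)^[n] x)

/-- The separation time of two points of `core`: the first time at which their iterates lie in
different partition elements. -/
def separation (x y : ℝ) : ℕ := sInf {n | D.itinerary g x n ≠ D.itinerary g y n}

end ReturnData

/-- `D` describes a Markov return map of `g` to the interval `(-δ, δ)`. -/
structure IsMarkovReturn (g : ℝ → ℝ) (δ : ℝ) (D : ReturnData) : Prop where
  delta_pos : 0 < δ
  delta_lt_one : δ < 1
  left_lt_right : ∀ l, D.left l < D.right l
  subset : ∀ l, D.piece l ⊆ Ioo (-δ) δ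
  disjoint : Pairwise fun l m => Disjoint (D.piece l) (D.piece m)
  covers : volume (Ioo (-δ) δ \ D.domain) = 0
  time_pos : ∀ l, 0 < D.time l
  /-- the orbit of a point is defined up to its return time -/
  orbit_ne_zero : ∀ l, ∀ x ∈ D.piece l, ∀ j < D.time l, g^[j] x ≠ 0
  /-- every branch is a bijection onto the whole interval; for a Lorenz map `g` it is then a
  diffeomorphism, since `g` is smooth with nonvanishing derivative along the orbits involved -/
  bijOn : ∀ l, BijOn (D.returnMap g) (D.piece l) (Ioo (-δ) δ)
  integrable_time : IntegrableOn (fun x => (D.returnTime x : ℝ)) (Ioo (-δ) δ) volume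
  distortion : ∃ c : ℝ, 0 < c ∧ c < 1 ∧ ∀ l, ∀ x ∈ D.piece l, ∀ y ∈ D.piece l,
    x ∈ D.core g → y ∈ D.core g →
      Real.log (|deriv (D.returnMap g) x| / |deriv (D.returnMap g) y|) ≤ c ^ D.separation g x y

/-- `m` is an absolutely continuous ergodic (in particular, invariant) probability measure on
`(-δ, δ)` for the return map. -/
structure IsErgodicACProbability (g : ℝ → ℝ) (δ : ℝ) (D : ReturnData) (m : Measure ℝ) :
    Prop where
  prob : IsProbabilityMeasure m
  ac : m ≪ volume.restrict (Ioo (-δ) δ)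
  ergodic : Ergodic (D.returnMap g) m

/-! ### The two-sided countable shift -/

/-- The full shift space `ℕ^ℤ`, with the product topology, which is the one generated by
cylinders, and its Borel σ-algebra. -/
abbrev TwoSided : Type := ℤ → ℕ

/-- The space of pasts, `ℕ^{n < 0}`. -/
abbrev Past : Type := {n : ℤ // n < 0} → ℕ

/-- The space of futures, `ℕ^{n ≥ 0}`. -/
abbrev Future : Type := ℕ → ℕ

/-- The shift map on `ℕ^ℤ`. -/
def shift (x : TwoSided) : TwoSided := fun n => x (n + 1)

/-- The projection to the past. -/
def projPast (x : TwoSided) : Past := fun n => x n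

/-- The projection to the future. -/
def projFuture (x : TwoSided) : Future := fun n => x n

/-- The homeomorphism `x ↦ (x_s, x_u)` from `ℕ^ℤ` onto the product of pasts and futures. -/
def splitting : TwoSided ≃ₜ Past × Future where
  toFun x := (projPast x, projFuture x)
  invFun z n := if h : n < 0 then z.1 ⟨n, h⟩ else z.2 n.toNat
  left_inv x := by
    funext n
    by_cases h : n < 0
    · simp [h, projPast]
    · simp [h, projFuture, Int.toNat_of_nonneg (not_lt.mp h)]
  right_inv z := by
    ext n
    · simp [projPast, n.2]
    · simp [projFuture]
  continuous_toFun := by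
    unfold projPast projFuture
    fun_prop
  continuous_invFun := by
    refine continuous_pi fun n => ?_
    by_cases h : n < 0
    · simp only [h, dite_true]
      fun_prop
    · simp only [h, dite_false]
      fun_prop

/-- `μ` is the lift to `ℕ^ℤ` of the measure `ν` on `ℕ^{n ≥ 0}`: the shift-invariant ergodic
probability measure that projects to `ν`. -/
structure IsLift (ν : Measure Future) (μ : Measure TwoSided) : Prop where
  prob : IsProbabilityMeasure μ
  ergodic : Ergodic shift μ
  map_projFuture : μ.map projFuture = ν

/-- `μ = ω (μ_s × μ_u)`, where `μ_s` and `μ_u` are the projections of `μ` to pasts and futures and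
`ω : ℕ^ℤ → (0, ∞)` is measurable; the product measure is carried to `ℕ^ℤ` by `splitting`. -/
structure IsProductDensity (μ : Measure TwoSided) (ω : TwoSided → ℝ) : Prop where
  measurable : Measurable ω
  pos : ∀ x, 0 < ω x
  eq_withDensity : μ = (((μ.map projPast).prod (μ.map projFuture)).map
    splitting.symm).withDensity fun x => ENNReal.ofReal (ω x)

end

end LorenzShift

open Set Filter Topology MeasureTheory
open scoped ENNReal

namespace LorenzShift

/-! Let λ be the image of Lebesgue measure on `(-δ, δ)` under the itinerary map, and ν the image of
`m`. Since every branch of the return map is onto, prepending a symbol corresponds to applying one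
full inverse branch. The derivative estimate then says that, inside a set of sequences sharing `n`
symbols, prepending a symbol preserves ratios of λ-measures up to factors controlled by `exp (c ^ (n
+ 1))`. Along a word of any length the errors form a geometric series, so the total factor is `exp
(O(c ^ n))`, whatever the word (`HasBoundedDistortion.branch_mul_le`).

The measure ν inherits this. By invariance ν(A) is the ν-measure of a far preimage of A. Replacing
dν/dλ by an L¹-close function of finitely many symbols turns that measure into a weighted sum of
λ(wA) over words w, so ν/λ oscillates by at most `exp (O(c ^ n))` on sets sharing `n` symbols
(`HasBoundedDistortion.invariant_mul_le`). Passing from ν to λ and back gives distortion bounds for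
ν (`HasBoundedDistortion.invariant_branch_mul_le`). All finite words also get positive ν-measure.

For the two-sided measure, compare μ of a window around the origin with the product of the measures
of its past and future halves. Lengthening either half by one symbol changes the logarithm of this
ratio by `O(c ^ k)`, uniformly in the point (`HasBoundedDistortion.abs_logRatio_sub_le`). The
locally constant log ratios therefore converge uniformly to a bounded continuous function L. The
approximate densities are exact on cylinders, so `exp L` is the density in the limit
(`exists_isProductDensity`). -/

/-- The sequences in `E` have the same first `n` symbols. -/
def Agree (n : ℕ) (E : Set Future) : Prop := ∀ a ∈ E, ∀ b ∈ E, ∀ i < n, a i = b i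

/-- The sequences which start with the first `k` symbols of `x` and continue with an element
of `A`. -/
def branch (x : Future) (k : ℕ) (A : Set Future) : Set Future :=
  {y | (∀ i < k, y i = x i) ∧ (fun i => y (i + k)) ∈ A}

/-! ### Interval dynamics: expansion, coding and comparison of derivatives. -/

section Interval

variable {g : ℝ → ℝ} {δ : ℝ} {D : ReturnData}

namespace IsMarkovReturn

theorem label_eq (hD : IsMarkovReturn g δ D) {l : ℕ} {x : ℝ} (hx : x ∈ D.piece l) :
    D.label x = l := by
  have h : ∃ l, x ∈ D.piece l := ⟨l, hx⟩
  have h1 : x ∈ D.piece (D.label x) := by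
    unfold ReturnData.label
    rw [dif_pos h]
    exact h.choose_spec
  by_contra hne
  exact Set.disjoint_left.1 (hD.disjoint hne) h1 hx

theorem returnMap_eq (hD : IsMarkovReturn g δ D) {l : ℕ} {x : ℝ} (hx : x ∈ D.piece l) :
    D.returnMap g x = g^[D.time l] x := by
  have h : x ∈ D.domain := mem_iUnion.2 ⟨l, hx⟩
  simp only [ReturnData.returnMap, if_pos h, ReturnData.returnTime, hD.label_eq hx]

theorem isOpen_piece (D : ReturnData) (l : ℕ) : IsOpen (D.piece l) := isOpen_Ioo

theorem isOpen_domain (D : ReturnData) : IsOpen D.domain :=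
  isOpen_iUnion fun l => isOpen_piece D l

theorem iterate_mem_lorenzDomain (hg : IsLorenzMap g) (hD : IsMarkovReturn g δ D) {l : ℕ} {x : ℝ}
    (hx : x ∈ D.piece l) : ∀ j < D.time l, g^[j] x ∈ lorenzDomain := by
  intro j
  induction j with
  | zero =>
    intro h
    refine ⟨?_, hD.orbit_ne_zero l x hx 0 h⟩
    have h1 := hD.subset l hx
    have h2 := hD.delta_lt_one
    exact ⟨by simpa using (by linarith [h1.1] : (-1 : ℝ) ≤ x),
      by simpa using (by linarith [h1.2] : x ≤ 1)⟩
  | succ j ih =>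
    intro h
    refine ⟨?_, hD.orbit_ne_zero l x hx _ h⟩
    rw [Function.iterate_succ_apply']
    exact hg.mapsTo (ih (by omega))

/-- The branches of the return map are differentiable and uniformly expanding. -/
theorem exists_expansion (hg : IsLorenzMap g) (hD : IsMarkovReturn g δ D) :
    ∃ κ : ℝ, 1 < κ ∧ ∀ l, ∀ x ∈ D.piece l, DifferentiableAt ℝ (D.returnMap g) x ∧
      κ ≤ |deriv (D.returnMap g) x| := by
  obtain ⟨θ, hθ, h2, hexp⟩ := hg.expanding
  have h1 : 1 < θ⁻¹ := lt_trans (by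
    rw [Real.lt_sqrt] <;> norm_num) h2
  refine ⟨θ⁻¹, h1, fun l x hx => ?_⟩
  -- The orbit may hit `±1`, where `g` is only known to be differentiable within its domain. So the
  -- chain rule is run within the piece, and openness of the piece gives an ordinary derivative at
  -- the end.
  have key : ∀ j ≤ D.time l, ∃ d : ℝ, HasDerivWithinAt (g^[j]) d (D.piece l) x ∧
      (θ⁻¹) ^ j ≤ |d| := by
    intro j
    induction j with
    | zero =>
      intro _
      exact ⟨1, by simpa using hasDerivWithinAt_id x (D.piece l), by simp⟩
    | succ j ih =>
      intro hj
      obtain ⟨d, hd, hd'⟩ := ih (by omega)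
      have hmem := hD.iterate_mem_lorenzDomain hg hx j (by omega)
      have hgd : HasDerivWithinAt g (derivWithin g lorenzDomain (g^[j] x)) lorenzDomain
          (g^[j] x) :=
        ((hg.smooth.differentiableOn (by simp)) _ hmem).hasDerivWithinAt
      refine ⟨derivWithin g lorenzDomain (g^[j] x) * d, ?_, ?_⟩
      · rw [Function.iterate_succ']
        exact hgd.comp x hd fun y hy => hD.iterate_mem_lorenzDomain hg hy j (by omega)
      · rw [abs_mul, pow_succ']
        exact mul_le_mul (hexp _ hmem) hd' (by positivity) (abs_nonneg _)
  obtain ⟨d, hd, hd'⟩ := key _ le_rfl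
  have hF : HasDerivAt (D.returnMap g) d x := by
    refine (hd.hasDerivAt ((isOpen_piece D l).mem_nhds hx)).congr_of_eventuallyEq ?_
    filter_upwards [(isOpen_piece D l).mem_nhds hx] with y hy
    exact hD.returnMap_eq hy
  refine ⟨hF.differentiableAt, ?_⟩
  rw [hF.deriv]
  calc θ⁻¹ = θ⁻¹ ^ 1 := (pow_one _).symm
    _ ≤ θ⁻¹ ^ D.time l := pow_le_pow_right₀ h1.le (hD.time_pos l)
    _ ≤ |d| := hd'

theorem returnMap_mem (hD : IsMarkovReturn g δ D) {x : ℝ} (hx : x ∈ D.domain) :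
    D.returnMap g x ∈ Ioo (-δ) δ := by
  obtain ⟨l, hl⟩ := mem_iUnion.1 hx
  exact (hD.bijOn l).mapsTo hl

theorem returnMap_mem_core {x : ℝ} (hx : x ∈ D.core g) : D.returnMap g x ∈ D.core g := by
  intro n
  rw [← Function.iterate_succ_apply]
  exact hx (n + 1)

theorem mem_core_of_returnMap_mem {x : ℝ} (hx : x ∈ D.domain) (h : D.returnMap g x ∈ D.core g) :
    x ∈ D.core g := by
  intro n
  cases n with
  | zero => exact hx
  | succ n => exact h n

theorem itinerary_returnMap (x : ℝ) :
    D.itinerary g (D.returnMap g x) = fun n => D.itinerary g x (n + 1) := by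
  funext n
  simp only [ReturnData.itinerary, Function.iterate_succ_apply]

theorem mem_piece_label (hD : IsMarkovReturn g δ D) {x : ℝ} (hx : x ∈ D.domain) :
    x ∈ D.piece (D.label x) := by
  obtain ⟨l, hl⟩ := mem_iUnion.1 hx
  rwa [hD.label_eq hl]

theorem mul_abs_sub_le {κ : ℝ} (hκ : ∀ l, ∀ x ∈ D.piece l,
    DifferentiableAt ℝ (D.returnMap g) x ∧ κ ≤ |deriv (D.returnMap g) x|) {l : ℕ} {x y : ℝ}
    (hx : x ∈ D.piece l) (hy : y ∈ D.piece l) :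
    κ * |x - y| ≤ |D.returnMap g x - D.returnMap g y| := by
  wlog hxy : x < y generalizing x y
  · rcases eq_or_lt_of_le (not_lt.1 hxy) with h | h
    · simp [h]
    · rw [abs_sub_comm x, abs_sub_comm (D.returnMap g x)]
      exact this hy hx h
  have hsub : Icc x y ⊆ D.piece l := fun z hz =>
    ⟨lt_of_lt_of_le hx.1 hz.1, lt_of_le_of_lt hz.2 hy.2⟩
  obtain ⟨z, hz, hz'⟩ := exists_deriv_eq_slope (D.returnMap g) hxy
    (fun z hz => (hκ l z (hsub hz)).1.continuousAt.continuousWithinAt)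
    (fun z hz => (hκ l z (hsub (Ioo_subset_Icc_self hz))).1.differentiableWithinAt)
  have h1 := (hκ l z (hsub (Ioo_subset_Icc_self hz))).2
  have hpos : 0 < |y - x| := abs_pos.2 (by linarith)
  rw [hz', abs_div, le_div_iff₀ hpos] at h1
  rwa [abs_sub_comm x, abs_sub_comm (D.returnMap g x)]

/-- Points of the core are determined by their itinerary. -/
theorem injOn_itinerary (hg : IsLorenzMap g) (hD : IsMarkovReturn g δ D) :
    InjOn (D.itinerary g) (D.core g) := by
  intro x hx y hy hxy
  obtain ⟨κ, hκ1, hκ⟩ := hD.exists_expansion hg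
  have hp : ∀ n, (D.returnMap g)^[n] x ∈ D.piece (D.itinerary g x n) ∧
      (D.returnMap g)^[n] y ∈ D.piece (D.itinerary g x n) := by
    intro n
    refine ⟨hD.mem_piece_label (hx n), ?_⟩
    rw [hxy]
    exact hD.mem_piece_label (hy n)
  -- Expansion separates the two orbits exponentially, while both stay in an interval of length `2 *
  -- δ`.
  have key : ∀ n, κ ^ n * |x - y| ≤ |(D.returnMap g)^[n] x - (D.returnMap g)^[n] y| := by
    intro n
    induction n with
    | zero => simp
    | succ n ih =>
      rw [Function.iterate_succ_apply', Function.iterate_succ_apply', pow_succ', mul_assoc]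
      exact (mul_le_mul_of_nonneg_left ih (by linarith)).trans
        (mul_abs_sub_le hκ (hp n).1 (hp n).2)
  by_contra hne
  have hpos : 0 < |x - y| := abs_pos.2 (sub_ne_zero.2 hne)
  obtain ⟨n, hn⟩ := pow_unbounded_of_one_lt (2 * δ / |x - y|) hκ1
  rw [div_lt_iff₀ hpos] at hn
  have h1 := hD.subset _ (hp n).1
  have h2 := hD.subset _ (hp n).2
  have h3 : |(D.returnMap g)^[n] x - (D.returnMap g)^[n] y| ≤ 2 * δ :=
    abs_le.2 ⟨by linarith [h1.1, h2.2], by linarith [h1.2, h2.1]⟩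
  linarith [key n]

theorem measurable_label (hD : IsMarkovReturn g δ D) : Measurable D.label := by
  refine measurable_to_countable' fun l => ?_
  have h : D.label ⁻¹' {l} = D.piece l ∪ (D.domainᶜ ∩ {_x | (0 : ℕ) = l}) := by
    ext x
    by_cases hx : x ∈ D.domain
    · simp only [mem_preimage, mem_singleton_iff, mem_union, mem_inter_iff, mem_compl_iff, hx,
        not_true_eq_false, false_and, or_false]
      exact ⟨fun h => h ▸ hD.mem_piece_label hx, hD.label_eq⟩
    · have h0 : D.label x = 0 := dif_neg fun h => hx (mem_iUnion.2 h)
      have h1 : x ∉ D.piece l := fun h => hx (mem_iUnion.2 ⟨l, h⟩)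
      simp [h0, h1, hx]
  rw [h]
  exact (isOpen_piece D l).measurableSet.union
    ((isOpen_domain D).measurableSet.compl.inter (MeasurableSet.const _))

theorem measurable_itinerary (hD : IsMarkovReturn g δ D) (hF : Measurable (D.returnMap g)) :
    Measurable (D.itinerary g) :=
  measurable_pi_lambda _ fun n => hD.measurable_label.comp (hF.iterate n)

theorem measurableSet_core (hF : Measurable (D.returnMap g)) : MeasurableSet (D.core g) := by
  have h : D.core g = ⋂ n, (D.returnMap g)^[n] ⁻¹' D.domain := by
    ext x; simp [ReturnData.core]
  rw [h]
  exact MeasurableSet.iInter fun n => hF.iterate n (isOpen_domain D).measurableSet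

theorem volume_image (hg : IsLorenzMap g) (hD : IsMarkovReturn g δ D) {l : ℕ} {X : Set ℝ}
    (hX : MeasurableSet X) (hXl : X ⊆ D.piece l) :
    volume (D.returnMap g '' X) = ∫⁻ x in X, ENNReal.ofReal |deriv (D.returnMap g) x| := by
  obtain ⟨κ, -, hκ⟩ := hD.exists_expansion hg
  have := lintegral_image_eq_lintegral_abs_deriv_mul hX
    (fun x hx => (hκ l x (hXl hx)).1.hasDerivAt.hasDerivWithinAt)
    ((hD.bijOn l).injOn.mono hXl) (fun _ => 1)
  simpa using this

/-- A branch has derivative at least 1 in absolute value, so it cannot map a set of positive measure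
to a null set. The measurable hull is needed because `N` is arbitrary. -/
theorem volume_piece_inter_preimage (hg : IsLorenzMap g) (hD : IsMarkovReturn g δ D)
    (hF : Measurable (D.returnMap g)) (l : ℕ) {N : Set ℝ} (hN : volume N = 0) :
    volume (D.piece l ∩ D.returnMap g ⁻¹' N) = 0 := by
  obtain ⟨κ, hκ1, hκ⟩ := hD.exists_expansion hg
  have hM := measurableSet_toMeasurable volume N
  have hX : MeasurableSet (D.piece l ∩ D.returnMap g ⁻¹' toMeasurable volume N) :=
    (isOpen_piece D l).measurableSet.inter (hF hM)
  refine measure_mono_null (inter_subset_inter_right _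
    (preimage_mono (subset_toMeasurable volume N))) ?_
  have h0 : volume (D.returnMap g '' (D.piece l ∩ D.returnMap g ⁻¹' toMeasurable volume N)) = 0 :=
    measure_mono_null (by rintro _ ⟨x, hx, rfl⟩; exact hx.2) ((measure_toMeasurable N).trans hN)
  rw [hD.volume_image hg hX inter_subset_left] at h0
  refine le_antisymm (h0 ▸ ?_) bot_le
  rw [← setLIntegral_one]
  refine setLIntegral_mono' hX fun x hx => ?_
  rw [← ENNReal.ofReal_one]
  exact ENNReal.ofReal_le_ofReal (hκ1.le.trans (hκ l x hx.1).2)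

theorem volume_diff_core (hg : IsLorenzMap g) (hD : IsMarkovReturn g δ D)
    (hF : Measurable (D.returnMap g)) : volume (Ioo (-δ) δ \ D.core g) = 0 := by
  have key : ∀ n, volume (Ioo (-δ) δ ∩ {x | (D.returnMap g)^[n] x ∉ D.domain}) = 0 := by
    intro n
    induction n with
    | zero => exact hD.covers
    | succ n ih =>
      refine measure_mono_null (t := (Ioo (-δ) δ \ D.domain) ∪ ⋃ l, D.piece l ∩
        D.returnMap g ⁻¹' (Ioo (-δ) δ ∩ {x | (D.returnMap g)^[n] x ∉ D.domain})) ?_ ?_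
      · rintro x ⟨hx, hx'⟩
        by_cases hd : x ∈ D.domain
        · obtain ⟨l, hl⟩ := mem_iUnion.1 hd
          exact Or.inr (mem_iUnion.2 ⟨l, hl, hD.returnMap_mem hd, hx'⟩)
        · exact Or.inl ⟨hx, hd⟩
      · exact measure_union_null hD.covers (measure_iUnion_null fun l =>
          hD.volume_piece_inter_preimage hg hF l ih)
  refine measure_mono_null (fun x hx => ?_) (measure_iUnion_null key)
  have := hx.2
  simp only [ReturnData.core, mem_ofPred_eq, not_forall] at this
  obtain ⟨n, hn⟩ := this
  exact mem_iUnion.2 ⟨n, hx.1, hn⟩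

/-- Comparison of derivatives at points whose itineraries share the first `n` symbols. -/
theorem abs_deriv_le (hg : IsLorenzMap g) (hD : IsMarkovReturn g δ D) {c : ℝ} (hc0 : 0 < c)
    (hc1 : c < 1) (hc : ∀ l, ∀ x ∈ D.piece l, ∀ y ∈ D.piece l,
      x ∈ D.core g → y ∈ D.core g →
      Real.log (|deriv (D.returnMap g) x| / |deriv (D.returnMap g) y|) ≤ c ^ D.separation g x y)
    {x y : ℝ} (hx : x ∈ D.core g) (hy : y ∈ D.core g) {n : ℕ}
    (hn : ∀ i < n + 1, D.itinerary g x i = D.itinerary g y i) :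
    |deriv (D.returnMap g) x| ≤ Real.exp (c ^ (n + 1)) * |deriv (D.returnMap g) y| := by
  obtain ⟨κ, hκ1, hκ⟩ := hD.exists_expansion hg
  have hpx : x ∈ D.piece (D.label x) := hD.mem_piece_label (hx 0)
  have hpy : y ∈ D.piece (D.label x) := by
    have h0 : D.label x = D.label y := hn 0 (by omega)
    rw [h0]
    exact hD.mem_piece_label (hy 0)
  have hposx : 0 < |deriv (D.returnMap g) x| := by linarith [(hκ _ x hpx).2]
  have hposy : 0 < |deriv (D.returnMap g) y| := by linarith [(hκ _ y hpy).2]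
  by_cases hxy : x = y
  · subst hxy
    exact le_mul_of_one_le_left hposx.le (Real.one_le_exp (by positivity))
  -- The infimum of the empty set is 0, so a lower bound on the separation time needs distinct
  -- points of the core to separate at some time. This is injectivity of the coding.
  have hne : {k | D.itinerary g x k ≠ D.itinerary g y k}.Nonempty := by
    by_contra h
    rw [not_nonempty_iff_eq_empty] at h
    refine hxy (hD.injOn_itinerary hg hx hy (funext fun k => ?_))
    by_contra hk
    have hk' : k ∈ {k | D.itinerary g x k ≠ D.itinerary g y k} := hk
    rw [h] at hk'
    exact hk'
  have hsep : n + 1 ≤ D.separation g x y := by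
    by_contra hlt
    exact Nat.sInf_mem hne (hn _ (not_le.1 hlt))
  have h1 := (hc _ x hpx y hpy hx hy).trans (pow_le_pow_of_le_one hc0.le hc1.le hsep)
  rw [Real.log_le_iff_le_exp (div_pos hposx hposy), div_le_iff₀ hposy] at h1
  exact h1

end IsMarkovReturn

end Interval

/-! ### Distortion of Lebesgue measure in symbolic form. -/

/-- Prepending a symbol distorts the measure of subsets of a set whose elements share the first
`n` symbols at most by the factor `exp (c ^ (n + 1))`. -/
def HasBoundedDistortion (c : ℝ) (lam : Measure Future) : Prop :=
  ∀ n E, Agree n E → ∀ x : Future, ∃ d : ℝ≥0∞, ∀ A ⊆ E, MeasurableSet A →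
    lam A ≤ ENNReal.ofReal (Real.exp (c ^ (n + 1))) * (d * lam (branch x 1 A)) ∧
    d * lam (branch x 1 A) ≤ ENNReal.ofReal (Real.exp (c ^ (n + 1))) * lam A

theorem measurableSet_branch (x : Future) (k : ℕ) {A : Set Future} (hA : MeasurableSet A) :
    MeasurableSet (branch x k A) := by
  have h : branch x k A = (⋂ i, ⋂ (_ : i < k), {y : Future | y i = x i}) ∩
      (fun y : Future => fun i => y (i + k)) ⁻¹' A := by
    ext y; simp [branch]
  rw [h]
  refine (MeasurableSet.iInter fun i => MeasurableSet.iInter fun _ =>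
    measurableSet_eq_fun (measurable_pi_apply i) measurable_const).inter ?_
  exact (measurable_pi_lambda _ fun i => measurable_pi_apply (i + k)) hA

/-- The branch labelled by the prepended symbol maps the points coded by `branch z 1 A` bijectively
onto those coded by `A`. By change of variables `lam A` is the integral of the absolute derivative
over the former set, where it is almost constant. -/
theorem IsMarkovReturn.exists_hasBoundedDistortion {g : ℝ → ℝ} {δ : ℝ} {D : ReturnData}
    (hg : IsLorenzMap g) (hD : IsMarkovReturn g δ D) (hF : Measurable (D.returnMap g)) :
    ∃ c : ℝ, 0 < c ∧ c < 1 ∧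
      HasBoundedDistortion c ((volume.restrict (Ioo (-δ) δ)).map (D.itinerary g)) := by
  obtain ⟨c, hc0, hc1, hc⟩ := hD.distortion
  refine ⟨c, hc0, hc1, fun n E hE z => ?_⟩
  obtain ⟨κ, hκ1, hκ⟩ := hD.exists_expansion hg
  have hI := hD.measurable_itinerary hF
  have hcore := measurableSet_core (D := D) hF
  set F := D.returnMap g with hFdef
  have hsubI : D.core g ⊆ Ioo (-δ) δ := fun x hx => by
    obtain ⟨l, hl⟩ := mem_iUnion.1 (hx 0)
    exact hD.subset l hl
  -- Points outside the core carry meaningless itineraries, but they form a null set.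
  have hlam : ∀ A, MeasurableSet A →
      ((volume.restrict (Ioo (-δ) δ)).map (D.itinerary g)) A =
        volume (D.core g ∩ D.itinerary g ⁻¹' A) := by
    intro A hA
    rw [Measure.map_apply hI hA, Measure.restrict_apply (hI hA)]
    refine le_antisymm ?_ (measure_mono fun x hx => ⟨hx.2, hsubI hx.1⟩)
    refine (measure_mono (t := (D.core g ∩ D.itinerary g ⁻¹' A) ∪ (Ioo (-δ) δ \ D.core g))
      fun x hx => ?_).trans ((measure_union_le _ _).trans
        (by rw [hD.volume_diff_core hg hF, add_zero]))
    by_cases h : x ∈ D.core g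
    · exact Or.inl ⟨h, hx.1⟩
    · exact Or.inr ⟨hx.2, h⟩
  let X : Set Future → Set ℝ := fun A => D.core g ∩ D.itinerary g ⁻¹' (branch z 1 A)
  have hXpiece : ∀ A, X A ⊆ D.piece (z 0) := by
    intro A x hx
    have h1 : D.label x = z 0 := hx.2.1 0 (by omega)
    rw [← h1]
    exact hD.mem_piece_label (hx.1 0)
  have hXm : ∀ A, MeasurableSet A → MeasurableSet (X A) := fun A hA =>
    hcore.inter (hI (measurableSet_branch z 1 hA))
  have himage : ∀ A, F '' X A = D.core g ∩ D.itinerary g ⁻¹' A := by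
    intro A
    ext y
    constructor
    · rintro ⟨x, hx, rfl⟩
      refine ⟨returnMap_mem_core hx.1, ?_⟩
      rw [mem_preimage, itinerary_returnMap]
      exact hx.2.2
    · rintro ⟨hy, hyA⟩
      obtain ⟨x, hx, rfl⟩ := (hD.bijOn (z 0)).surjOn (hsubI hy)
      refine ⟨x, ⟨mem_core_of_returnMap_mem (mem_iUnion.2 ⟨_, hx⟩) hy, fun i hi => ?_, ?_⟩, rfl⟩
      · obtain rfl : i = 0 := by omega
        exact hD.label_eq hx
      · rw [mem_preimage, itinerary_returnMap] at hyA
        exact hyA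
  by_cases hne : (X E).Nonempty
  swap
  -- With no coded point over `E`, surjectivity of the branch forces `lam A = 0`, so any `d` would
  -- do.
  · refine ⟨0, fun A hA hAm => ?_⟩
    have : X A = ∅ := by
      rw [not_nonempty_iff_eq_empty] at hne
      exact subset_empty_iff.1 (hne ▸ fun x hx => ⟨hx.1, hx.2.1, hA hx.2.2⟩)
    rw [hlam A hAm, ← himage, this]
    simp
  obtain ⟨y, hy⟩ := hne
  -- The derivative at one reference point serves as the scaling factor.
  refine ⟨ENNReal.ofReal |deriv F y|, fun A hA hAm => ?_⟩
  have hXE : X A ⊆ X E := fun x hx => ⟨hx.1, hx.2.1, hA hx.2.2⟩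
  have hagree : ∀ a ∈ X E, ∀ b ∈ X E, |deriv F a| ≤ Real.exp (c ^ (n + 1)) * |deriv F b| := by
    intro a ha b hb
    -- The prepended symbol is common too, so the itineraries share `n + 1` symbols.
    refine hD.abs_deriv_le hg hc0 hc1 hc ha.1 hb.1 fun i hi => ?_
    cases i with
    | zero => rw [ha.2.1 0 (by omega), hb.2.1 0 (by omega)]
    | succ i => exact hE _ ha.2.2 _ hb.2.2 i (by omega)
  rw [hlam A hAm, hlam _ (measurableSet_branch z 1 hAm), ← himage,
    hD.volume_image hg (hXm A hAm) (hXpiece A)]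
  change _ ≤ _ * (_ * volume (X A)) ∧ _ * volume (X A) ≤ _
  constructor
  · rw [← mul_assoc, ← ENNReal.ofReal_mul (Real.exp_pos _).le, ← setLIntegral_const]
    exact setLIntegral_mono' (hXm A hAm) fun x hx =>
      ENNReal.ofReal_le_ofReal (hagree x (hXE hx) y hy)
  · rw [← setLIntegral_const, ← lintegral_const_mul' _ _ ENNReal.ofReal_ne_top]
    refine setLIntegral_mono' (hXm A hAm) fun x hx => ?_
    rw [← ENNReal.ofReal_mul (Real.exp_pos _).le]
    exact ENNReal.ofReal_le_ofReal (hagree y hy x (hXE hx))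

/-! ### Distortion along words of arbitrary length. -/

theorem branch_succ (x : Future) (k : ℕ) (A : Set Future) :
    branch x (k + 1) A = branch x 1 (branch (fun i => x (i + 1)) k A) := by
  ext y
  constructor
  · rintro ⟨h1, h2⟩
    exact ⟨fun i hi => h1 i (by omega), fun i hi => h1 (i + 1) (by omega), h2⟩
  · rintro ⟨h1, h2, h3⟩
    refine ⟨fun i hi => ?_, h3⟩
    cases i with
    | zero => exact h1 0 (by omega)
    | succ i => exact h2 i (by omega)

theorem branch_zero (x : Future) (A : Set Future) : branch x 0 A = A := by
  ext y; simp [branch]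

theorem branch_mono (x : Future) (k : ℕ) {A B : Set Future} (h : A ⊆ B) :
    branch x k A ⊆ branch x k B := fun _ hy => ⟨hy.1, h hy.2⟩

theorem Agree.branch {n : ℕ} {E : Set Future} (hE : Agree n E) (x : Future) (k : ℕ) :
    Agree (n + k) (branch x k E) := by
  intro a ha b hb i hi
  by_cases h : i < k
  · rw [ha.1 i h, hb.1 i h]
  · have := hE _ ha.2 _ hb.2 (i - k) (by omega)
    simpa [Nat.sub_add_cancel (not_lt.1 h)] using this

section Distortion

variable {c : ℝ} {lam : Measure Future}

/-- The exponent is the geometric sum `c ^ (n + 1) + ... + c ^ (n + k)`: each prepended symbol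
lengthens the common prefix by one and so improves the next estimate. -/
theorem HasBoundedDistortion.iterate (h : HasBoundedDistortion c lam) (hc1 : c < 1)
    {n : ℕ} {E : Set Future} (hE : Agree n E) (k : ℕ) (x : Future) :
    ∃ d : ℝ≥0∞, ∀ A ⊆ E, MeasurableSet A →
      lam A ≤ ENNReal.ofReal (Real.exp (c / (1 - c) * (c ^ n - c ^ (n + k)))) *
        (d * lam (branch x k A)) ∧
      d * lam (branch x k A) ≤
        ENNReal.ofReal (Real.exp (c / (1 - c) * (c ^ n - c ^ (n + k)))) * lam A := by
  induction k generalizing x with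
  | zero => exact ⟨1, fun A _ _ => by simp [branch_zero]⟩
  | succ k ih =>
    obtain ⟨d, hd⟩ := ih fun i => x (i + 1)
    obtain ⟨e, he⟩ := h (n + k) _ (hE.branch (fun i => x (i + 1)) k) x
    refine ⟨d * e, fun A hA hAm => ?_⟩
    obtain ⟨h1, h2⟩ := hd A hA hAm
    obtain ⟨h3, h4⟩ := he _ (branch_mono _ k hA) (measurableSet_branch _ k hAm)
    have hexp : ENNReal.ofReal (Real.exp (c / (1 - c) * (c ^ n - c ^ (n + (k + 1))))) =
        ENNReal.ofReal (Real.exp (c / (1 - c) * (c ^ n - c ^ (n + k)))) *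
          ENNReal.ofReal (Real.exp (c ^ (n + k + 1))) := by
      rw [← ENNReal.ofReal_mul (Real.exp_pos _).le, ← Real.exp_add]
      congr 2
      have : 1 - c ≠ 0 := by linarith
      field_simp
      ring
    rw [branch_succ, hexp]
    set K := ENNReal.ofReal (Real.exp (c / (1 - c) * (c ^ n - c ^ (n + k))))
    set L := ENNReal.ofReal (Real.exp (c ^ (n + k + 1)))
    constructor
    · calc lam A ≤ K * (d * lam (branch (fun i => x (i + 1)) k A)) := h1
        _ ≤ K * (d * (L * (e * lam (branch x 1 (branch (fun i => x (i + 1)) k A))))) := by gcongr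
        _ = _ := by ring
    · calc _ = d * (e * lam (branch x 1 (branch (fun i => x (i + 1)) k A))) := by ring
        _ ≤ d * (L * lam (branch (fun i => x (i + 1)) k A)) := by gcongr
        _ = L * (d * lam (branch (fun i => x (i + 1)) k A)) := by ring
        _ ≤ L * (K * lam A) := by gcongr
        _ = _ := by ring

/-- Comparing `A` with `B` eliminates the unknown scaling factor `d`. Dropping the negative term of
the exponent makes the bound uniform in `k`. -/
theorem HasBoundedDistortion.branch_mul_le (h : HasBoundedDistortion c lam) (hc0 : 0 < c)
    (hc1 : c < 1) {n : ℕ} {E : Set Future} (hE : Agree n E) (k : ℕ) (x : Future)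
    {A B : Set Future} (hA : A ⊆ E) (hAm : MeasurableSet A) (hB : B ⊆ E) (hBm : MeasurableSet B) :
    lam (branch x k A) * lam B ≤
      ENNReal.ofReal (Real.exp (2 * (c / (1 - c)) * c ^ n)) * (lam (branch x k B) * lam A) := by
  obtain ⟨d, hd⟩ := h.iterate hc1 hE k x
  have h1 := (hd B hB hBm).1
  have h2 := (hd A hA hAm).2
  set K := ENNReal.ofReal (Real.exp (c / (1 - c) * (c ^ n - c ^ (n + k)))) with hK
  have hKK : K * K ≤ ENNReal.ofReal (Real.exp (2 * (c / (1 - c)) * c ^ n)) := by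
    rw [hK, ← ENNReal.ofReal_mul (Real.exp_pos _).le, ← Real.exp_add]
    apply ENNReal.ofReal_le_ofReal
    apply Real.exp_le_exp.2
    have h3 : 0 ≤ c / (1 - c) := div_nonneg hc0.le (by linarith)
    have h4 : 0 ≤ c / (1 - c) * c ^ (n + k) := by positivity
    linarith
  calc lam (branch x k A) * lam B ≤ lam (branch x k A) * (K * (d * lam (branch x k B))) := by
        gcongr
    _ = K * lam (branch x k B) * (d * lam (branch x k A)) := by ring
    _ ≤ K * lam (branch x k B) * (K * lam A) := by gcongr
    _ = K * K * (lam (branch x k B) * lam A) := by ring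
    _ ≤ _ := by gcongr

theorem HasBoundedDistortion.branch_ne_zero (h : HasBoundedDistortion c lam)
    (hc1 : c < 1) (k : ℕ) (x : Future) {A : Set Future} (hAm : MeasurableSet A)
    (hA : lam A ≠ 0) : lam (branch x k A) ≠ 0 := by
  have hE : Agree 0 (univ : Set Future) := fun a _ b _ i hi => by omega
  obtain ⟨d, hd⟩ := h.iterate hc1 hE k x
  intro h0
  have := (hd A (subset_univ _) hAm).1
  rw [h0] at this
  simp only [mul_zero, nonpos_iff_eq_zero] at this
  exact hA this

/-! ### Absolutely continuous invariant measures. -/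

/-- The sequences whose shift by `k` symbols lies in `A`. -/
def tailIn (k : ℕ) (A : Set Future) : Set Future := {y | (fun i => y (i + k)) ∈ A}

theorem measurableSet_tailIn (k : ℕ) {A : Set Future} (hA : MeasurableSet A) :
    MeasurableSet (tailIn k A) :=
  (measurable_pi_lambda _ fun i => measurable_pi_apply (i + k) :
    Measurable fun y : Future => fun i => y (i + k)) hA

/-- Extension of a finite word by zeros. -/
def extendWord (k : ℕ) (w : Fin k → ℕ) : Future := fun i => if h : i < k then w ⟨i, h⟩ else 0

theorem setLIntegral_tailIn {φ : Future → ℝ≥0∞} {N : ℕ}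
    (hφ : DependsOn φ (Iic N)) {A : Set Future} (hA : MeasurableSet A) :
    ∫⁻ y in tailIn (N + 1) A, φ y ∂lam = ∑' w : Fin (N + 1) → ℕ,
      φ (extendWord _ w) * lam (branch (extendWord _ w) (N + 1) A) := by
  have hU : tailIn (N + 1) A = ⋃ w : Fin (N + 1) → ℕ, branch (extendWord _ w) (N + 1) A := by
    ext y
    simp only [mem_iUnion]
    constructor
    · intro hy
      exact ⟨fun i => y i, fun i hi => by simp [extendWord, hi], hy⟩
    · rintro ⟨w, -, hw⟩
      exact hw
  have hdisj : Pairwise (Function.onFun Disjoint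
      fun w : Fin (N + 1) → ℕ => branch (extendWord _ w) (N + 1) A) := by
    intro w w' hne
    refine Set.disjoint_left.2 fun y hy hy' => hne (funext fun i => ?_)
    have := (hy.1 i i.2).symm.trans (hy'.1 i i.2)
    simpa only [extendWord, i.2, dif_pos] using this
  rw [hU, lintegral_iUnion (fun w => measurableSet_branch _ _ hA) hdisj]
  refine tsum_congr fun w => ?_
  rw [← setLIntegral_const]
  refine setLIntegral_congr_fun (measurableSet_branch _ _ hA) fun y hy => ?_
  exact hφ fun i hi => hy.1 i (Nat.lt_succ_of_le hi)

/-- Both integrals split over the first `N + 1` symbols, on which `φ` is constant, and the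
distortion bound applies word by word. The constant does not depend on `N` or `φ`, which allows the
approximation of a density afterwards. -/
theorem HasBoundedDistortion.setLIntegral_tailIn_mul_le (h : HasBoundedDistortion c lam)
    (hc0 : 0 < c) (hc1 : c < 1) {n : ℕ} {E : Set Future} (hE : Agree n E)
    {A B : Set Future} (hA : A ⊆ E) (hAm : MeasurableSet A) (hB : B ⊆ E) (hBm : MeasurableSet B)
    {φ : Future → ℝ≥0∞} {N : ℕ} (hφ : DependsOn φ (Iic N)) :
    (∫⁻ y in tailIn (N + 1) A, φ y ∂lam) * lam B ≤
      ENNReal.ofReal (Real.exp (2 * (c / (1 - c)) * c ^ n)) *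
        ((∫⁻ y in tailIn (N + 1) B, φ y ∂lam) * lam A) := by
  rw [setLIntegral_tailIn hφ hAm, setLIntegral_tailIn hφ hBm, ← ENNReal.tsum_mul_right,
    ← ENNReal.tsum_mul_right, ← ENNReal.tsum_mul_left]
  refine ENNReal.tsum_le_tsum fun w => ?_
  exact (mul_assoc _ _ _).trans_le ((mul_le_mul_right
    (h.branch_mul_le hc0 hc1 hE _ _ hA hAm hB hBm) _).trans_eq (by ring))

/-- Lévy's upward theorem: the conditional expectations of the density given the first symbols
converge to it in L¹. An L¹ error controls all sets `S` simultaneously. -/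
theorem exists_cylinder_approximation [IsFiniteMeasure lam] {ν : Measure Future}
    [IsFiniteMeasure ν] (hν : ν ≪ lam) {ε : ℝ≥0∞} (hε : 0 < ε) :
    ∃ (N : ℕ) (φ : Future → ℝ≥0∞), DependsOn φ (Iic N) ∧ ∀ S, MeasurableSet S →
      ν S ≤ (∫⁻ y in S, φ y ∂lam) + ε ∧ (∫⁻ y in S, φ y ∂lam) ≤ ν S + ε := by
  let h : Future → ℝ := fun y => (ν.rnDeriv lam y).toReal
  have hint : Integrable h lam := Measure.integrable_toReal_rnDeriv
  have hsup : (⨆ n, (Filtration.piLE (X := fun _ : ℕ => ℕ)) n) = MeasurableSpace.pi := by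
    refine le_antisymm (iSup_le fun n => Filtration.le _ n) (iSup_le fun i => ?_)
    refine le_trans ?_ (le_iSup _ i)
    rw [← measurable_iff_comap_le]
    change Measurable[(Filtration.piLE (X := fun _ : ℕ => ℕ)) i] fun y : Future => y i
    exact (measurable_pi_apply (⟨i, mem_Iic.2 le_rfl⟩ : Iic i)).comp
      (comap_measurable (Preorder.restrictLe i))
  have hmeas : StronglyMeasurable[⨆ n, (Filtration.piLE (X := fun _ : ℕ => ℕ)) n] h := by
    rw [hsup]
    exact (Measure.measurable_rnDeriv ν lam).ennreal_toReal.stronglyMeasurable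
  have hlim := hint.tendsto_eLpNorm_condExp hmeas
  obtain ⟨N, hN⟩ := (hlim.eventually (gt_mem_nhds hε)).exists
  set f : Future → ℝ := lam[h | (Filtration.piLE (X := fun _ : ℕ => ℕ)) N] with hf
  have hfd : DependsOn f (Iic N) := StronglyMeasurable.dependsOn_of_piLE stronglyMeasurable_condExp
  have hfm : Measurable f := (stronglyMeasurable_condExp.mono (Filtration.le _ N)).measurable
  have hhm : Measurable h := (Measure.measurable_rnDeriv ν lam).ennreal_toReal
  rw [eLpNorm_one_eq_lintegral_enorm] at hN
  have hνS : ∀ S, ν S = ∫⁻ y in S, ENNReal.ofReal (h y) ∂lam := by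
    intro S
    rw [← Measure.setLIntegral_rnDeriv hν S]
    refine lintegral_congr_ae (ae_restrict_of_ae ?_)
    filter_upwards [Measure.rnDeriv_lt_top ν lam] with y hy
    exact (ENNReal.ofReal_toReal hy.ne).symm
  have hbd : ∀ S, (∫⁻ y in S, ‖(f - h) y‖ₑ ∂lam) ≤ ε := fun S =>
    (setLIntegral_le_lintegral S _).trans hN.le
  have hpt : ∀ a b : ℝ, ENNReal.ofReal a ≤ ENNReal.ofReal b + ‖a - b‖ₑ := by
    intro a b
    rw [← ofReal_norm]
    refine (ENNReal.ofReal_le_ofReal ?_).trans ENNReal.ofReal_add_le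
    linarith [le_abs_self (a - b), Real.norm_eq_abs (a - b)]
  refine ⟨N, fun y => ENNReal.ofReal (f y), fun x y hxy => by simp only [hfd hxy],
    fun S hS => ⟨?_, ?_⟩⟩
  · rw [hνS]
    calc _ ≤ ∫⁻ y in S, (ENNReal.ofReal (f y) + ‖(f - h) y‖ₑ) ∂lam := by
          refine lintegral_mono fun y => (hpt (h y) (f y)).trans_eq ?_
          rw [Pi.sub_apply, ← enorm_neg, neg_sub]
      _ = _ := lintegral_add_left hfm.ennreal_ofReal _
      _ ≤ _ := by gcongr; exact hbd S
  · rw [hνS]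
    calc _ ≤ ∫⁻ y in S, (ENNReal.ofReal (h y) + ‖(f - h) y‖ₑ) ∂lam :=
          lintegral_mono fun y => hpt (f y) (h y)
      _ = _ := lintegral_add_left hhm.ennreal_ofReal _
      _ ≤ _ := by gcongr; exact hbd S

/-- A shift-invariant measure which is absolutely continuous with respect to a measure with
bounded distortion is comparable with it, with a density of small oscillation on cylinders. -/
theorem HasBoundedDistortion.invariant_mul_le [IsFiniteMeasure lam]
    (h : HasBoundedDistortion c lam) (hc0 : 0 < c) (hc1 : c < 1) {ν : Measure Future}
    [IsFiniteMeasure ν] (hν : ν ≪ lam)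
    (hinv : ∀ k A, MeasurableSet A → ν (tailIn k A) = ν A)
    {n : ℕ} {E : Set Future} (hE : Agree n E)
    {A B : Set Future} (hA : A ⊆ E) (hAm : MeasurableSet A) (hB : B ⊆ E) (hBm : MeasurableSet B) :
    ν A * lam B ≤
      ENNReal.ofReal (Real.exp (2 * (c / (1 - c)) * c ^ n)) * (ν B * lam A) := by
  set K := ENNReal.ofReal (Real.exp (2 * (c / (1 - c)) * c ^ n)) with hK
  -- Invariance replaces `A` and `B` by their preimages at depth `N + 1`, a depth that depends on
  -- `ε`. The sets `A` and `B` themselves stay fixed, so `ε` can tend to 0.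
  have key : ∀ ε : ℝ≥0∞, 0 < ε → ν A * lam B ≤ K * ((ν B + ε) * lam A) + ε * lam B := by
    intro ε hε
    obtain ⟨N, φ, hφ, happ⟩ := exists_cylinder_approximation hν hε
    have h1 := (happ _ (measurableSet_tailIn (N + 1) hAm)).1
    have h2 := (happ _ (measurableSet_tailIn (N + 1) hBm)).2
    rw [hinv _ _ hAm] at h1
    rw [hinv _ _ hBm] at h2
    calc ν A * lam B ≤ ((∫⁻ y in tailIn (N + 1) A, φ y ∂lam) + ε) * lam B := by gcongr
      _ = (∫⁻ y in tailIn (N + 1) A, φ y ∂lam) * lam B + ε * lam B := add_mul _ _ _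
      _ ≤ K * ((∫⁻ y in tailIn (N + 1) B, φ y ∂lam) * lam A) + ε * lam B := by
        exact add_le_add_left (h.setLIntegral_tailIn_mul_le hc0 hc1 hE hA hAm hB hBm hφ) _
      _ ≤ _ := by gcongr
  have hlim : Tendsto (fun ε : ℝ≥0∞ => K * ((ν B + ε) * lam A) + ε * lam B) (𝓝[>] 0)
      (𝓝 (K * ((ν B + 0) * lam A) + 0 * lam B)) := by
    have hKt : K ≠ ∞ := ENNReal.ofReal_ne_top
    have hid : Tendsto (fun ε : ℝ≥0∞ => ε) (𝓝[>] 0) (𝓝 0) := nhdsWithin_le_nhds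
    refine Tendsto.add (ENNReal.Tendsto.const_mul (ENNReal.Tendsto.mul_const
      (tendsto_const_nhds.add hid) (Or.inr (measure_ne_top _ _))) (Or.inr hKt))
      (ENNReal.Tendsto.mul_const hid (Or.inr (measure_ne_top _ _)))
  have := ge_of_tendsto hlim (eventually_mem_nhdsWithin.mono fun ε hε => key ε hε)
  simpa using this

end Distortion

/-- Bounded distortion is inherited by an absolutely continuous invariant measure. -/
theorem HasBoundedDistortion.invariant_branch_mul_le {c : ℝ} {lam : Measure Future}
    [IsFiniteMeasure lam] (h : HasBoundedDistortion c lam) (hc0 : 0 < c) (hc1 : c < 1)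
    {ν : Measure Future} [IsFiniteMeasure ν] (hν : ν ≪ lam)
    (hinv : ∀ k A, MeasurableSet A → ν (tailIn k A) = ν A)
    {n : ℕ} {E : Set Future} (hE : Agree n E) (k : ℕ) (x : Future)
    {A B : Set Future} (hA : A ⊆ E) (hAm : MeasurableSet A) (hB : B ⊆ E) (hBm : MeasurableSet B)
    (hA0 : lam A ≠ 0) (hB0 : lam B ≠ 0) :
    ν.real (branch x k A) * ν.real B ≤
      Real.exp (6 * (c / (1 - c)) * c ^ n) * (ν.real (branch x k B) * ν.real A) := by
  have hc2 : 0 ≤ c / (1 - c) := div_nonneg hc0.le (by linarith)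
  have toReal : ∀ {a b a' b' : ℝ≥0∞} {t : ℝ}, a ≠ ∞ → b ≠ ∞ → a' ≠ ∞ → b' ≠ ∞ →
      a * b ≤ ENNReal.ofReal (Real.exp t) * (a' * b') →
      a.toReal * b.toReal ≤ Real.exp t * (a'.toReal * b'.toReal) := by
    intro a b a' b' t _ _ ha' hb' hab
    have := ENNReal.toReal_mono (ENNReal.mul_ne_top ENNReal.ofReal_ne_top
      (ENNReal.mul_ne_top ha' hb')) hab
    rwa [ENNReal.toReal_mul, ENNReal.toReal_mul, ENNReal.toReal_mul,
      ENNReal.toReal_ofReal (Real.exp_pos _).le] at this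
  have h1 := toReal (measure_ne_top _ _) (measure_ne_top _ _) (measure_ne_top _ _)
    (measure_ne_top _ _) (h.invariant_mul_le hc0 hc1 hν hinv (hE.branch x k) (branch_mono x k hA)
    (measurableSet_branch x k hAm) (branch_mono x k hB) (measurableSet_branch x k hBm))
  have h2 := toReal (measure_ne_top _ _) (measure_ne_top _ _) (measure_ne_top _ _)
    (measure_ne_top _ _) (h.branch_mul_le hc0 hc1 hE k x hA hAm hB hBm)
  have h3 := toReal (measure_ne_top _ _) (measure_ne_top _ _) (measure_ne_top _ _)
    (measure_ne_top _ _) (h.invariant_mul_le hc0 hc1 hν hinv hE hB hBm hA hAm)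
  have hpos : ∀ S, lam S ≠ 0 → 0 < (lam S).toReal := fun S hS =>
    ENNReal.toReal_pos hS (measure_ne_top _ _)
  have pA := hpos _ hA0
  have pB := hpos _ hB0
  have pxA := hpos _ (h.branch_ne_zero hc1 k x hAm hA0)
  have pxB := hpos _ (h.branch_ne_zero hc1 k x hBm hB0)
  have hK : Real.exp (2 * (c / (1 - c)) * c ^ (n + k)) ≤
      Real.exp (2 * (c / (1 - c)) * c ^ n) :=
    Real.exp_le_exp.2 (mul_le_mul_of_nonneg_left
      (pow_le_pow_of_le_one hc0.le hc1.le (by omega)) (by positivity))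
  have hK3 : Real.exp (6 * (c / (1 - c)) * c ^ n) = Real.exp (2 * (c / (1 - c)) * c ^ n) *
      Real.exp (2 * (c / (1 - c)) * c ^ n) * Real.exp (2 * (c / (1 - c)) * c ^ n) := by
    rw [← Real.exp_add, ← Real.exp_add]
    ring_nf
  rw [hK3]
  simp only [measureReal_def]
  set K := Real.exp (2 * (c / (1 - c)) * c ^ n)
  have h1' := h1.trans (mul_le_mul_of_nonneg_right hK (by positivity))
  -- The comparison goes from ν to λ after prepending, then across the branch for λ, then back to ν
  -- before prepending. The four λ-factors cancel because they are positive, which leaves three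
  -- factors `K`.
  have hmul := mul_le_mul (mul_le_mul h1' h2 (by positivity) (by positivity)) h3 (by positivity)
    (by positivity)
  refine le_of_mul_le_mul_right ?_ (mul_pos (mul_pos pA pB) (mul_pos pxA pxB))
  calc _ = _ := by ring
    _ ≤ _ := hmul
    _ = _ := by ring

theorem HasBoundedDistortion.invariant_ne_zero {c : ℝ} {lam : Measure Future}
    [IsFiniteMeasure lam] (h : HasBoundedDistortion c lam) (hc0 : 0 < c) (hc1 : c < 1)
    {ν : Measure Future} [IsProbabilityMeasure ν] (hν : ν ≪ lam)
    (hinv : ∀ k A, MeasurableSet A → ν (tailIn k A) = ν A) {A : Set Future}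
    (hAm : MeasurableSet A) (hA : lam A ≠ 0) : ν A ≠ 0 := by
  intro h0
  have := h.invariant_mul_le hc0 hc1 hν hinv (n := 0) (E := univ)
    (fun a _ b _ i hi => by omega) (subset_univ _) MeasurableSet.univ (subset_univ A) hAm
  rw [h0, measure_univ, one_mul, zero_mul, mul_zero] at this
  exact hA (le_antisymm this bot_le)

theorem branch_add (x : Future) (k l : ℕ) (A : Set Future) :
    branch x (k + l) A = branch x k (branch (fun i => x (i + k)) l A) := by
  have hA : ∀ y : Future, (fun i => y (i + (k + l))) = fun i => y (i + l + k) := fun y =>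
    funext fun i => by rw [add_assoc, add_comm l k]
  ext y
  constructor
  · rintro ⟨h1, h2⟩
    exact ⟨fun i hi => h1 i (by omega), fun i hi => h1 (i + k) (by omega), hA y ▸ h2⟩
  · rintro ⟨h1, h2, h3⟩
    refine ⟨fun i hi => ?_, (hA y).symm ▸ h3⟩
    by_cases h : i < k
    · exact h1 i h
    · have := h2 (i - k) (by omega)
      simpa [Nat.sub_add_cancel (not_lt.1 h)] using this

theorem agree_branch_univ (x : Future) (k : ℕ) : Agree k (branch x k univ) :=
  fun _ ha _ hb i hi => (ha.1 i hi).trans (hb.1 i hi).symm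

/-! ### Two-sided windows and their measures. -/

/-- The sequences which agree with `x` at the positions `-j ≤ i < k`. -/
def window (x : TwoSided) (j k : ℕ) : Set TwoSided :=
  {z | ∀ i : ℤ, -(j : ℤ) ≤ i → i < k → z i = x i}

/-- The set of futures which corresponds to `window x j k` under a shift by `j`. -/
def windowBranch (x : TwoSided) (j k : ℕ) : Set Future :=
  branch (fun i => x (i - j)) j (branch (projFuture x) k univ)

theorem measurable_projFuture : Measurable projFuture :=
  measurable_pi_lambda _ fun n => measurable_pi_apply (n : ℤ)

theorem measurable_projPast : Measurable projPast :=
  measurable_pi_lambda _ fun n => measurable_pi_apply (n : ℤ)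

theorem shift_iterate (j : ℕ) (z : TwoSided) (i : ℤ) : shift^[j] z i = z (i + j) := by
  induction j generalizing z with
  | zero => simp
  | succ j ih =>
    rw [Function.iterate_succ_apply, ih]
    simp only [shift]
    congr 1
    push_cast
    ring

theorem measurableSet_window (x : TwoSided) (j k : ℕ) : MeasurableSet (window x j k) := by
  have h : window x j k = ⋂ i : ℤ, ⋂ (_ : -(j : ℤ) ≤ i), ⋂ (_ : i < k),
      {z : TwoSided | z i = x i} := by
    ext z; simp [window]
  rw [h]
  exact MeasurableSet.iInter fun i => MeasurableSet.iInter fun _ => MeasurableSet.iInter fun _ =>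
    measurableSet_eq_fun (measurable_pi_apply i) measurable_const

theorem measurableSet_windowBranch (x : TwoSided) (j k : ℕ) :
    MeasurableSet (windowBranch x j k) :=
  measurableSet_branch _ _ (measurableSet_branch _ _ MeasurableSet.univ)

theorem projFuture_preimage_windowBranch (x : TwoSided) (j k : ℕ) :
    projFuture ⁻¹' windowBranch x j k = shift^[j] ⁻¹' window x j k := by
  ext w
  constructor
  · rintro ⟨h1, h2, -⟩ i hi hik
    rw [shift_iterate]
    by_cases h : i < 0
    · have := h1 (i + j).toNat (by omega)
      simp only [projFuture] at this
      rw [Int.toNat_of_nonneg (by omega)] at this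
      simpa using this
    · have := h2 i.toNat (by omega)
      simp only [projFuture] at this
      push_cast at this
      rwa [Int.toNat_of_nonneg (by omega)] at this
  · intro h
    refine ⟨fun i hi => ?_, fun i hi => ?_, mem_univ _⟩
    · have := h (i - j) (by omega) (by omega)
      rw [shift_iterate] at this
      simpa [projFuture] using this
    · have := h i (by omega) (by omega)
      rw [shift_iterate] at this
      simpa [projFuture] using this

theorem measure_window {ν : Measure Future} {μ : Measure TwoSided} (hμ : IsLift ν μ)
    (x : TwoSided) (j k : ℕ) : μ.real (window x j k) = ν.real (windowBranch x j k) := by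
  rw [measureReal_def, measureReal_def, ← hμ.map_projFuture,
    Measure.map_apply measurable_projFuture (measurableSet_windowBranch x j k),
    projFuture_preimage_windowBranch,
    (hμ.ergodic.toMeasurePreserving.iterate j).measure_preimage
      (measurableSet_window x j k).nullMeasurableSet]

theorem IsLift.measure_tailIn {ν : Measure Future} {μ : Measure TwoSided} (hμ : IsLift ν μ)
    (k : ℕ) {A : Set Future} (hA : MeasurableSet A) : ν (tailIn k A) = ν A := by
  rw [← hμ.map_projFuture, Measure.map_apply measurable_projFuture (measurableSet_tailIn k hA),
    Measure.map_apply measurable_projFuture hA]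
  have : projFuture ⁻¹' tailIn k A = shift^[k] ⁻¹' (projFuture ⁻¹' A) := by
    ext w
    simp only [tailIn, mem_preimage, mem_ofPred_eq]
    have : (fun i => projFuture w (i + k)) = projFuture (shift^[k] w) := by
      funext i
      simp [projFuture, shift_iterate]
    rw [this]
  rw [this, (hμ.ergodic.toMeasurePreserving.iterate k).measure_preimage
      (measurable_projFuture hA).nullMeasurableSet]

theorem branch_univ_subset (x : TwoSided) (k d : ℕ) :
    branch (projFuture x) (k + d) univ ⊆ branch (projFuture x) k univ :=
  fun _ hy => ⟨fun i hi => hy.1 i (by omega), mem_univ _⟩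

theorem windowBranch_add (x : TwoSided) (j k d : ℕ) :
    windowBranch x (j + d) k = branch (fun i => x (i - (j + d : ℕ))) d (windowBranch x j k) := by
  unfold windowBranch
  rw [add_comm j d, branch_add]
  congr 2
  funext i
  congr 1
  push_cast
  ring

theorem windowBranch_zero_left (x : TwoSided) (k : ℕ) :
    windowBranch x 0 k = branch (projFuture x) k univ := branch_zero _ _

theorem windowBranch_zero_right (x : TwoSided) (j : ℕ) :
    windowBranch x j 0 = branch (fun i => x (i - j)) j univ := by
  unfold windowBranch
  rw [branch_zero]

/-! ### Geometric convergence of the logarithmic ratios. -/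

/-- The logarithm of the density of `μ` with respect to the product of its projections, on the
level of cylinders. -/
noncomputable def logRatio (μ : Measure TwoSided) (x : TwoSided) (j k : ℕ) : ℝ :=
  Real.log (μ.real (window x j k)) - Real.log (μ.real (window x j 0)) -
    Real.log (μ.real (window x 0 k))

theorem abs_log_sub_le {a b a' b' t : ℝ} (ha : 0 < a) (hb : 0 < b) (ha' : 0 < a') (hb' : 0 < b')
    (h : a * b ≤ Real.exp t * (a' * b')) (h' : a' * b' ≤ Real.exp t * (a * b)) :
    |(Real.log a + Real.log b) - (Real.log a' + Real.log b')| ≤ t := by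
  have h1 := Real.log_le_log (by positivity) h
  have h2 := Real.log_le_log (by positivity) h'
  rw [Real.log_mul (Real.exp_pos _).ne' (by positivity), Real.log_exp,
    Real.log_mul ha.ne' hb.ne', Real.log_mul ha'.ne' hb'.ne'] at h1 h2
  exact abs_le.2 ⟨by linarith, by linarith⟩

/-- The logarithmic ratios of a lift form a Cauchy sequence, with a uniform geometric rate. -/
theorem HasBoundedDistortion.abs_logRatio_sub_le {c : ℝ} {lam : Measure Future}
    [IsFiniteMeasure lam] (hlam : lam univ ≠ 0) (h : HasBoundedDistortion c lam) (hc0 : 0 < c)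
    (hc1 : c < 1) {ν : Measure Future} [IsProbabilityMeasure ν] (hν : ν ≪ lam)
    {μ : Measure TwoSided} (hμ : IsLift ν μ) :
    (∀ x j k, 0 < μ.real (window x j k)) ∧
    ∃ C : ℝ, ∀ x k, |logRatio μ x k k - logRatio μ x (k + 1) (k + 1)| ≤ C * c ^ k := by
  have hinv : ∀ k A, MeasurableSet A → ν (tailIn k A) = ν A := fun k A hA =>
    hμ.measure_tailIn k hA
  have hbr : ∀ (y : Future) k, lam (branch y k univ) ≠ 0 := fun y k =>
    h.branch_ne_zero hc1 k y MeasurableSet.univ hlam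
  have hwin : ∀ x j k, lam (windowBranch x j k) ≠ 0 := fun x j k =>
    h.branch_ne_zero hc1 _ _ (measurableSet_branch _ _ MeasurableSet.univ) (hbr _ _)
  have hpos : ∀ x j k, 0 < μ.real (window x j k) := fun x j k => by
    rw [measure_window hμ]
    exact ENNReal.toReal_pos (h.invariant_ne_zero hc0 hc1 hν hinv
      (measurableSet_windowBranch x j k) (hwin x j k)) (measure_ne_top _ _)
  refine ⟨hpos, 2 * (6 * (c / (1 - c))), fun x k => ?_⟩
  -- Here the `k` past symbols are prepended to the future cylinders of lengths `k` and `k + 1`; the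
  -- past factor cancels in the difference.
  have hfut : |logRatio μ x k k - logRatio μ x k (k + 1)| ≤ 6 * (c / (1 - c)) * c ^ k := by
    have hE := agree_branch_univ (projFuture x) k
    have hs := branch_univ_subset x k 1
    have hm : ∀ l, MeasurableSet (branch (projFuture x) l univ) := fun l =>
      measurableSet_branch _ _ MeasurableSet.univ
    have h1 := h.invariant_branch_mul_le hc0 hc1 hν hinv hE k (fun i => x (i - k)) Subset.rfl
      (hm k) hs (hm (k + 1)) (hbr _ _) (hbr _ _)
    have h2 := h.invariant_branch_mul_le hc0 hc1 hν hinv hE k (fun i => x (i - k)) hs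
      (hm (k + 1)) Subset.rfl (hm k) (hbr _ _) (hbr _ _)
    change ν.real (windowBranch x k k) * _ ≤ _ * (ν.real (windowBranch x k (k + 1)) * _) at h1
    change ν.real (windowBranch x k (k + 1)) * _ ≤ _ * (ν.real (windowBranch x k k) * _) at h2
    rw [← windowBranch_zero_left, ← windowBranch_zero_left] at h1 h2
    simp only [← measure_window hμ] at h1 h2
    have := abs_log_sub_le (hpos _ _ _) (hpos _ _ _) (hpos _ _ _) (hpos _ _ _) h1 h2
    refine le_trans (le_of_eq ?_) this
    unfold logRatio
    congr 1
    ring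
  -- Here a single symbol, at position `-(k + 1)`, is prepended to the windows with and without the
  -- future part. They share the `k` past symbols, and the future factor cancels.
  have hpast : |logRatio μ x k (k + 1) - logRatio μ x (k + 1) (k + 1)| ≤
      6 * (c / (1 - c)) * c ^ k := by
    have hE : Agree k (windowBranch x k 0) := by
      rw [windowBranch_zero_right]
      exact agree_branch_univ _ k
    have hs : windowBranch x k (k + 1) ⊆ windowBranch x k 0 := by
      rw [windowBranch_zero_right]
      exact branch_mono _ _ (subset_univ _)
    have h1 := h.invariant_branch_mul_le hc0 hc1 hν hinv hE 1 (fun i => x (i - (k + 1 : ℕ)))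
      Subset.rfl (measurableSet_windowBranch x k 0) hs (measurableSet_windowBranch x k (k + 1))
      (hwin _ _ _) (hwin _ _ _)
    have h2 := h.invariant_branch_mul_le hc0 hc1 hν hinv hE 1 (fun i => x (i - (k + 1 : ℕ)))
      hs (measurableSet_windowBranch x k (k + 1)) Subset.rfl (measurableSet_windowBranch x k 0)
      (hwin _ _ _) (hwin _ _ _)
    rw [← windowBranch_add, ← windowBranch_add] at h1 h2
    simp only [← measure_window hμ] at h1 h2
    have := abs_log_sub_le (hpos _ _ _) (hpos _ _ _) (hpos _ _ _) (hpos _ _ _) h1 h2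
    refine le_trans (le_of_eq ?_) this
    unfold logRatio
    congr 1
    ring
  calc _ ≤ _ := abs_sub_le _ (logRatio μ x k (k + 1)) _
    _ ≤ _ := add_le_add hfut hpast
    _ = _ := by ring

theorem window_congr {x y : TwoSided} {j k : ℕ}
    (h : ∀ i : ℤ, -(j : ℤ) ≤ i → i < k → y i = x i) : window y j k = window x j k := by
  ext z
  exact forall_congr' fun i => forall_congr' fun h1 => forall_congr' fun h2 => by rw [h i h1 h2]

theorem logRatio_congr (μ : Measure TwoSided) {x y : TwoSided} {k : ℕ} (h : y ∈ window x k k) :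
    logRatio μ y k k = logRatio μ x k k := by
  unfold logRatio
  rw [window_congr (x := x) (y := y) (j := k) (k := k) h,
    window_congr (x := x) (y := y) (j := k) (k := 0) fun i h1 h2 => h i h1 (by omega),
    window_congr (x := x) (y := y) (j := 0) (k := k) fun i h1 h2 => h i (by omega) h2]

theorem window_mem_nhds (x : TwoSided) (j k : ℕ) : window x j k ∈ 𝓝 x := by
  have h : ∀ᶠ y in 𝓝 x, ∀ i ∈ Finset.Ico (-(j : ℤ)) k, y i = x i := by
    rw [Filter.eventually_all_finset]
    intro i _
    exact (continuous_apply i).continuousAt.preimage_mem_nhds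
      ((isOpen_discrete {x i}).mem_nhds rfl)
  filter_upwards [h] with y hy i h1 h2
  exact hy i (Finset.mem_Ico.2 ⟨h1, h2⟩)

theorem continuous_logRatio (μ : Measure TwoSided) (k : ℕ) :
    Continuous fun x => logRatio μ x k k := by
  refine continuous_iff_continuousAt.2 fun x => ?_
  refine continuousAt_const.congr (f := fun _ => logRatio μ x k k) ?_
  filter_upwards [window_mem_nhds x k k] with y hy
  exact (logRatio_congr μ hy).symm

/-! ### Construction of the density. -/

/-- The product of the projections of `μ` to pasts and futures, as a measure on `ℕ^ℤ`. -/
noncomputable def productOfProjections (μ : Measure TwoSided) : Measure TwoSided :=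
  ((μ.map projPast).prod (μ.map projFuture)).map splitting.symm

theorem productOfProjections_window (μ : Measure TwoSided) [IsFiniteMeasure μ] (x : TwoSided)
    (j k : ℕ) :
    productOfProjections μ (window x j k) = μ (window x j 0) * μ (window x 0 k) := by
  let P : Set Past := {p | ∀ i : {n : ℤ // n < 0}, -(j : ℤ) ≤ i → p i = x i}
  let Q : Set Future := {q | ∀ i < k, q i = x i}
  have hP : MeasurableSet P := by
    have : P = ⋂ i : {n : ℤ // n < 0}, ⋂ (_ : -(j : ℤ) ≤ i), {p : Past | p i = x i} := by
      ext; simp [P]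
    rw [this]
    exact MeasurableSet.iInter fun i => MeasurableSet.iInter fun _ =>
      measurableSet_eq_fun (measurable_pi_apply i) measurable_const
  have hQ : MeasurableSet Q := by
    have : Q = ⋂ i : ℕ, ⋂ (_ : i < k), {p : Future | p i = x i} := by
      ext; simp [Q]
    rw [this]
    exact MeasurableSet.iInter fun i => MeasurableSet.iInter fun _ =>
      measurableSet_eq_fun (measurable_pi_apply i) measurable_const
  have h1 : projPast ⁻¹' P = window x j 0 := by
    ext z
    exact ⟨fun h i hi hi0 => h ⟨i, by simpa using hi0⟩ hi, fun h i hi => h i hi (by simp [i.2])⟩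
  have h2 : projFuture ⁻¹' Q = window x 0 k := by
    ext z
    constructor
    · intro h i hi hik
      have := h i.toNat (by omega)
      simp only [projFuture] at this
      rwa [Int.toNat_of_nonneg (by simpa using hi)] at this
    · exact fun h i hi => h i (by simp) (by exact_mod_cast hi)
  have h3 : window x j k = splitting ⁻¹' (P ×ˢ Q) := by
    have : splitting ⁻¹' (P ×ˢ Q) = projPast ⁻¹' P ∩ projFuture ⁻¹' Q := rfl
    rw [this, h1, h2]
    ext z
    constructor
    · exact fun h => ⟨fun i hi h0 => h i hi (by omega), fun i hi h0 => h i (by omega) h0⟩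
    · rintro ⟨ha, hb⟩ i hi hik
      by_cases h : i < 0
      · exact ha i hi (by simpa using h)
      · exact hb i (by simpa using h) hik
  have hsm : Measurable splitting.symm := splitting.symm.continuous.measurable
  rw [productOfProjections, Measure.map_apply hsm (measurableSet_window x j k), h3,
    ← preimage_comp]
  have hid : (splitting : TwoSided → Past × Future) ∘ splitting.symm = id :=
    funext splitting.apply_symm_apply
  rw [hid, preimage_id, Measure.prod_prod, Measure.map_apply measurable_projPast hP,
    Measure.map_apply measurable_projFuture hQ, h1, h2]

instance (μ : Measure TwoSided) [IsFiniteMeasure μ] : IsFiniteMeasure (productOfProjections μ) := by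
  unfold productOfProjections
  infer_instance

/-- On the level of cylinders, `exp ∘ logRatio` is the density of `μ`. -/
theorem map_restrict_withDensity_logRatio (μ : Measure TwoSided) [IsFiniteMeasure μ]
    (hpos : ∀ x j k, 0 < μ.real (window x j k)) (k : ℕ) :
    ((productOfProjections μ).withDensity fun x => ENNReal.ofReal
      (Real.exp (logRatio μ x k k))).map (Finset.Ico (-(k : ℤ)) k).restrict =
    μ.map (Finset.Ico (-(k : ℤ)) k).restrict := by
  have hr : Measurable ((Finset.Ico (-(k : ℤ)) k).restrict (π := fun _ => ℕ)) :=
    Finset.measurable_restrict _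
  -- Finite words form a countable space, so it suffices to check one window at a time. There
  -- `logRatio` is constant and equality is its definition.
  refine Measure.ext_of_singleton fun a => ?_
  rw [Measure.map_apply hr (measurableSet_singleton a),
    Measure.map_apply hr (measurableSet_singleton a)]
  let x : TwoSided := fun i => if h : i ∈ Finset.Ico (-(k : ℤ)) k then a ⟨i, h⟩ else 0
  have hx : (Finset.Ico (-(k : ℤ)) k).restrict (π := fun _ => ℕ) ⁻¹' {a} = window x k k := by
    ext z
    simp only [mem_preimage, mem_singleton_iff]
    constructor
    · rintro rfl i h1 h2
      simp [x, h1, h2]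
    · intro h
      funext i
      have hi := Finset.mem_Ico.1 i.2
      simpa [x, hi.1, hi.2] using h i hi.1 hi.2
  rw [hx, withDensity_apply _ (measurableSet_window x k k),
    setLIntegral_congr_fun (g := fun _ => ENNReal.ofReal (Real.exp (logRatio μ x k k)))
      (measurableSet_window x k k) fun y hy => by simp only [logRatio_congr μ hy],
    setLIntegral_const, productOfProjections_window]
  rw [← ofReal_measureReal (measure_ne_top μ (window x k k)),
    ← ofReal_measureReal (measure_ne_top μ (window x k 0)),
    ← ofReal_measureReal (measure_ne_top μ (window x 0 k)), ← ENNReal.ofReal_mul (hpos _ _ _).le, ← ENNReal.ofReal_mul (Real.exp_pos _).le]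
  congr 1
  unfold logRatio
  rw [Real.exp_sub, Real.exp_sub, Real.exp_log (hpos _ _ _), Real.exp_log (hpos _ _ _),
    Real.exp_log (hpos _ _ _)]
  have h1 := hpos x k 0
  have h2 := hpos x 0 k
  field_simp

/-- If the logarithmic ratios of cylinders converge geometrically and uniformly, then the measure
has product structure with a continuous density bounded away from zero and infinity. -/
theorem exists_isProductDensity (μ : Measure TwoSided) [IsProbabilityMeasure μ]
    (hpos : ∀ x j k, 0 < μ.real (window x j k)) {c C : ℝ} (hc0 : 0 < c) (hc1 : c < 1)
    (hC : ∀ x k, |logRatio μ x k k - logRatio μ x (k + 1) (k + 1)| ≤ C * c ^ k) :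
    ∃ ω : TwoSided → ℝ, IsProductDensity μ ω ∧ Continuous ω ∧
      ∃ a b : ℝ, 0 < a ∧ ∀ x, a ≤ ω x ∧ ω x ≤ b := by
  have hlim : ∀ x, ∃ l, Tendsto (fun k => logRatio μ x k k) atTop (𝓝 l) := fun x =>
    cauchySeq_tendsto_of_complete (cauchySeq_of_le_geometric c C hc1 (hC x))
  choose L hL using hlim
  have hdist : ∀ x k, |logRatio μ x k k - L x| ≤ C * c ^ k / (1 - c) := fun x k =>
    dist_le_of_le_geometric_of_tendsto c C hc1 (hC x) (hL x) k
  have hgeo : Tendsto (fun k : ℕ => C * c ^ k / (1 - c)) atTop (𝓝 0) := by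
    simpa using ((tendsto_pow_atTop_nhds_zero_of_lt_one hc0.le hc1).const_mul C).div_const (1 - c)
  have hunif : TendstoUniformly (fun k x => logRatio μ x k k) L atTop := by
    rw [Metric.tendstoUniformly_iff]
    intro ε hε
    filter_upwards [hgeo.eventually (gt_mem_nhds hε)] with k hk x
    rw [dist_comm]
    exact (hdist x k).trans_lt hk
  have hcont : Continuous L :=
    hunif.continuous (Frequently.of_forall fun k => continuous_logRatio μ k)
  -- The empty window has full measure, so the sequence starts at 0 and its limit is bounded by the
  -- whole geometric sum.
  have h0 : ∀ x, logRatio μ x 0 0 = 0 := by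
    intro x
    have : window x 0 0 = univ := by
      ext z
      simp only [mem_univ, iff_true]
      intro i h1 h2
      simp only [Nat.cast_zero, neg_zero] at h1 h2
      omega
    simp [logRatio, this]
  have hbound : ∀ x, |L x| ≤ C / (1 - c) := by
    intro x
    have := hdist x 0
    rwa [h0, zero_sub, abs_neg, pow_zero, mul_one] at this
  have hC0 : 0 ≤ C := by
    have := (abs_nonneg _).trans (hC (fun _ => 0) 0)
    simpa using this
  have hbound' : ∀ x k, logRatio μ x k k ≤ 2 * (C / (1 - c)) := by
    intro x k
    have h1 := (abs_le.1 (hdist x k)).2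
    have h2 := (abs_le.1 (hbound x)).2
    have h3 : C * c ^ k / (1 - c) ≤ C / (1 - c) :=
      div_le_div_of_nonneg_right (mul_le_of_le_one_right hC0 (pow_le_one₀ hc0.le hc1.le))
        (by linarith)
    linarith
  have hωc : Continuous fun x => Real.exp (L x) := Real.continuous_exp.comp hcont
  refine ⟨fun x => Real.exp (L x), ⟨hωc.measurable, fun x => Real.exp_pos _, ?_⟩, hωc,
    Real.exp (-(C / (1 - c))), Real.exp (C / (1 - c)), Real.exp_pos _, fun x =>
      ⟨Real.exp_le_exp.2 (abs_le.1 (hbound x)).1, Real.exp_le_exp.2 (abs_le.1 (hbound x)).2⟩⟩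
  change μ = (productOfProjections μ).withDensity fun x => ENNReal.ofReal (Real.exp (L x))
  -- On a fixed cylinder the approximate densities give exactly `μ S` once the window contains the
  -- coordinates involved. Dominated convergence passes to the limit, and cylinders are a generating
  -- π-system.
  have hcyl : ∀ S ∈ measurableCylinders (fun _ : ℤ => ℕ), μ S =
      ((productOfProjections μ).withDensity fun x => ENNReal.ofReal (Real.exp (L x))) S := by
    intro S hS
    have hSm := MeasurableSet.of_mem_measurableCylinders hS
    obtain ⟨s, T, hT, rfl⟩ := (mem_measurableCylinders _).1 hS
    obtain ⟨K, hK⟩ : ∃ K : ℕ, ∀ k ≥ K, s ⊆ Finset.Ico (-(k : ℤ)) k := by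
      refine ⟨s.sup Int.natAbs + 1, fun k hk i hi => ?_⟩
      have := Finset.le_sup (f := Int.natAbs) hi
      rw [Finset.mem_Ico]
      omega
    rw [withDensity_apply _ hSm]
    have heq : ∀ k ≥ K, ∫⁻ x in cylinder s T, ENNReal.ofReal (Real.exp (logRatio μ x k k))
        ∂productOfProjections μ = μ (cylinder s T) := by
      intro k hk
      have hr : Measurable ((Finset.Ico (-(k : ℤ)) k).restrict (π := fun _ => ℕ)) :=
        Finset.measurable_restrict _
      have hT' : MeasurableSet (Finset.restrict₂ (π := fun _ : ℤ => ℕ) (hK k hk) ⁻¹' T) :=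
        Finset.measurable_restrict₂ _ hT
      have hpre : cylinder s T = (Finset.Ico (-(k : ℤ)) k).restrict (π := fun _ => ℕ) ⁻¹'
          (Finset.restrict₂ (π := fun _ : ℤ => ℕ) (hK k hk) ⁻¹' T) := rfl
      have := congrArg (fun m => m (Finset.restrict₂ (π := fun _ : ℤ => ℕ) (hK k hk) ⁻¹' T))
        (map_restrict_withDensity_logRatio μ hpos k)
      rwa [Measure.map_apply hr hT', Measure.map_apply hr hT', ← hpre,
        withDensity_apply _ hSm] at this
    have hlim := tendsto_lintegral_of_dominated_convergence
      (μ := (productOfProjections μ).restrict (cylinder s T))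
      (F := fun k x => ENNReal.ofReal (Real.exp (logRatio μ x k k)))
      (f := fun x => ENNReal.ofReal (Real.exp (L x)))
      (fun _ => ENNReal.ofReal (Real.exp (2 * (C / (1 - c)))))
      (fun k => (Real.continuous_exp.comp (continuous_logRatio μ k)).measurable.ennreal_ofReal)
      (fun k => ae_of_all _ fun x => ENNReal.ofReal_le_ofReal
        (Real.exp_le_exp.2 (hbound' x k)))
      (by
        rw [lintegral_const]
        exact ENNReal.mul_ne_top ENNReal.ofReal_ne_top (measure_ne_top _ _))
      (ae_of_all _ fun x => ENNReal.tendsto_ofReal ((Real.continuous_exp.tendsto _).comp (hL x)))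
    refine tendsto_nhds_unique (tendsto_const_nhds.congr' ?_) hlim
    filter_upwards [eventually_ge_atTop K] with k hk
    exact (heq k hk).symm
  exact ext_of_generate_finite _ generateFrom_measurableCylinders.symm
    isPiSystem_measurableCylinders hcyl (hcyl _ (univ_mem_measurableCylinders _))

end LorenzShift

theorem proposition3p1
    (g : ℝ → ℝ) (hg : LorenzShift.IsLorenzMap g)
    (δ : ℝ) (D : LorenzShift.ReturnData) (hD : LorenzShift.IsMarkovReturn g δ D)
    (m : MeasureTheory.Measure ℝ) (hm : LorenzShift.IsErgodicACProbability g δ D m)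
    (μ : MeasureTheory.Measure LorenzShift.TwoSided)
    (hμ : LorenzShift.IsLift (m.map (D.itinerary g)) μ) :
    ∃ ω : LorenzShift.TwoSided → ℝ,
      LorenzShift.IsProductDensity μ ω ∧ Continuous ω ∧
        ∃ a b : ℝ, 0 < a ∧ ∀ x, a ≤ ω x ∧ ω x ≤ b := by
  -- Measurability of the return map is part of ergodicity.
  have hF := hm.ergodic.measurable
  have hI := hD.measurable_itinerary hF
  obtain ⟨c, hc0, hc1, hdist⟩ := hD.exists_hasBoundedDistortion hg hF
  have := hm.prob
  have := hμ.prob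
  have := Measure.isProbabilityMeasure_map (μ := m) hI.aemeasurable
  have hlam : ((volume.restrict (Ioo (-δ) δ)).map (D.itinerary g)) univ ≠ 0 := by
    rw [Measure.map_apply hI MeasurableSet.univ, preimage_univ, Measure.restrict_apply_univ,
      Real.volume_Ioo]
    simpa using hD.delta_pos
  obtain ⟨hpos, C, hC⟩ := hdist.abs_logRatio_sub_le hlam hc0 hc1 (hm.ac.map hI) hμ
  exact LorenzShift.exists_isProductDensity μ hpos hc0 hc1 hC
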